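/- For a finite simple graph $G$ and a positive integer $t$, an interval $t$-coloring of $G$ is a proper edge-coloring of $G$ with colors $1,\dots,t$ such that all colors are used and, for each vertex $v$, the set of colors of the edges incident to $v$ is an interval of integers. $G$ is interval colorable if it has an interval $t$-coloring for some positive integer $t$, and then $W(G)$ denotes the maximum number of colors in an interval coloring of $G$. For $m,k\ge 1$, let $H_m^k=K_m\square\cdots\square K_m$ be the Cartesian product of $k$ copies of the complete graph $K_m$. Let $k\ge 1$ and let $n=\prod_{i=1}^{\infty}p_i^{\alpha_i}$, where $p_i$ is the $i$th prime number and the $\alpha_i$ are non-negative integers, only finitely many of them non-zero. Put $$A_n=\alpha_1+2\alpha_2+3\alpha_3+4\alpha_4+4\alpha_5+\frac12\sum_{i=6}^{\infty}\alpha_i(p_i+1).$$ Then $H_{2n}^k$ is interval colorable and $$W(H_{2n}^k)\ \ge\ (4n-3-A_n)k+\tfrac12 k(k-1)(2n-1).$$ This improves Petrosyan's earlier bound $W(H_{2n}^k)\ge(4n-2-p-q)k$, where $n=p2^q$ with $p$ odd and $q$ a non-negative integer: the new lower bound is always at least $(4n-2-p-q)k$, and it is strictly larger whenever $k\ge 2$.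 -/

import Mathlib

namespace IntervalColoring

/-- `c` is an interval `t`-coloring of `G`: the colors occurring on the edges of `G` are exactly
`1, ..., t`, edges sharing a vertex get different colors, and for each vertex `v` the set of colors
of the edges incident to `v` is an interval of integers. (The values of `c` at pairs that are not
edges of `G` play no role.) -/
structure IsIntervalColoring {V : Type*} (G : SimpleGraph V) (t : ℕ) (c : Sym2 V → ℕ) : Prop where
  colors : c '' G.edgeSet = Set.Icc 1 t
  proper : ∀ v, Set.InjOn c (G.incidenceSet v)
  interval : ∀ v, (c '' G.incidenceSet v).OrdConnected

/-- The set of the positive integers `t` for which `G` has an interval `t`-coloring. -/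
def colorCounts {V : Type*} (G : SimpleGraph V) : Set ℕ :=
  {t | 0 < t ∧ ∃ c : Sym2 V → ℕ, IsIntervalColoring G t c}

/-- `G` is interval colorable. -/
def IntervalColorable {V : Type*} (G : SimpleGraph V) : Prop :=
  (colorCounts G).Nonempty

/-- `W(G)`: the maximum number of colors in an interval coloring of `G`
(for finite interval colorable `G`, see `isGreatest_W`). -/
noncomputable def W {V : Type*} (G : SimpleGraph V) : ℕ :=
  sSup (colorCounts G)

/-- For a finite interval colorable graph, `W G` is indeed the maximum. -/
theorem isGreatest_W {V : Type*} [Finite V] (G : SimpleGraph V) (h : IntervalColorable G) :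
    IsGreatest (colorCounts G) (W G) := by
  have hb : BddAbove (colorCounts G) := by
    refine ⟨G.edgeSet.ncard, ?_⟩
    rintro t ⟨-, c, hc⟩
    have h1 : (c '' G.edgeSet).ncard ≤ G.edgeSet.ncard := Set.ncard_image_le (Set.toFinite _)
    have h2 : (Set.Icc 1 t).ncard = t := by
      rw [Set.ncard_eq_toFinset_card']
      simp
    rw [hc.colors, h2] at h1
    exact h1
  exact ⟨Nat.sSup_mem h hb, fun t ht => le_csSup hb ht⟩

/-- The Cartesian product of a family of graphs: two vertices are adjacent if they are adjacent
in one coordinate and equal in all the other ones. -/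
def cartesianProduct {ι : Type*} {V : ι → Type*} (G : ∀ i, SimpleGraph (V i)) :
    SimpleGraph (∀ i, V i) where
  Adj x y := ∃ i, (G i).Adj (x i) (y i) ∧ ∀ j, j ≠ i → x j = y j
  symm := ⟨fun _ _ ⟨i, h, h'⟩ => ⟨i, h.symm, fun j hj => (h' j hj).symm⟩⟩
  loopless := ⟨fun _ ⟨_, h, _⟩ => h.ne rfl⟩

/-- The Hamming graph `H_m^k`: the Cartesian product of `k` copies of the complete graph `K_m`. -/
def hammingGraph (m k : ℕ) : SimpleGraph (Fin k → Fin m) :=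
  cartesianProduct fun _ : Fin k => (⊤ : SimpleGraph (Fin m))

/-- The quantity `α₁ + 2α₂ + 3α₃ + 4α₄ + 4α₅ + ½ ∑_{i ≥ 6} αᵢ (pᵢ + 1)`. Indices are shifted by one:
`αᵢ` is `α (i - 1)`, and the `i`th prime `pᵢ` is `Nat.nth Nat.Prime (i - 1)`. -/
noncomputable def A (α : ℕ →₀ ℕ) : ℚ :=
  α 0 + 2 * α 1 + 3 * α 2 + 4 * α 3 + 4 * α 4 +
    1 / 2 * ∑ i ∈ α.support with 5 ≤ i, (α i : ℚ) * ((Nat.nth Nat.Prime i : ℚ) + 1)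

/-- The lower bound `(4n - 3 - A)k + ½ k(k-1)(2n-1)`. -/
noncomputable def lowerBound (n k : ℕ) (α : ℕ →₀ ℕ) : ℚ :=
  (4 * n - 3 - A α) * k + 1 / 2 * k * (k - 1) * (2 * n - 1)

end IntervalColoring

open Finset

namespace IntervalColoring

/-! Call $f=2n-2-M$ the defect of a proper coloring of $K_{2n}$ whose color windows start at
positions from $0$ to $M$; it uses $M+2n-1=4n-3-f$ colors. Everything rests on defects adding under
multiplication of $n$ (`HasShift.mul`).

Since $M\le 2n-2$, the color $2n-1$ lies in every window, so its class is a perfect matching of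
$K_{2n}$. In $K_{2nm}$, on vertices $(x,i)$ with $x<2n$, $i<m$, each matched pair times the $m$
blocks spans a $K_{2m}$, colored by the given coloring of $K_{2m}$. All other edges keep their
first-factor color modulo $2n-1$, placed in level $i+j$ or $i+j+1$ according to whether that color
was below or above $2n-1$. Levels have $2n-2$ colors each and are interleaved with the $K_{2m}$
colors so that each vertex sees an interval.

The factors are primes: defect $1$ for $2$, $(p+1)/2$ for odd $p$ by an explicit family
(`hasShift_odd`), and $4$ for $11$ by a table. This gives defect $A_n$.

Finally, `IsRegularColoring.boxProd` adds copies of $K_{2n}$ one by one; each step gains the degree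
reached so far, and these gains sum to $\tfrac12k(k-1)(2n-1)$. -/

/-- `c` colors the edges of the complete graph on `0, ..., N - 1` properly, in such a way that the
colors at the vertex `u` are the `N - 1` integers following `w u`. -/
structure IsWindowColoring (N : ℕ) (w : ℕ → ℕ) (c : ℕ → ℕ → ℕ) : Prop where
  symm : ∀ u v, u < N → v < N → c u v = c v u
  lower : ∀ u v, u < N → v < N → u ≠ v → w u < c u v
  upper : ∀ u v, u < N → v < N → u ≠ v → c u v < w u + N
  inj : ∀ u v v', u < N → v < N → v' < N → u ≠ v → u ≠ v' → c u v = c u v' → v = v'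

/-- `w` takes values from `0` to `M` in increasing order on the vertices `0, ..., 2n - 1`, and
agrees on the vertices `2q` and `2q + 1`. -/
structure IsPairedShift (n M : ℕ) (w : ℕ → ℕ) : Prop where
  mono : ∀ u v, u ≤ v → v < 2 * n → w u ≤ w v
  pair : ∀ q < n, w (2 * q) = w (2 * q + 1)
  zero : w 0 = 0
  last : w (2 * n - 1) = M
  pos : 0 < n
  bound : M + 2 ≤ 2 * n

/-- The complete graph on `2n` vertices has an edge coloring whose windows of colors start
at positions that vary from `0` to `M`. -/
def HasShift (n M : ℕ) : Prop :=
  ∃ w c, IsWindowColoring (2 * n) w c ∧ IsPairedShift n M w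

/-- A vertex has $N-1$ edges with distinct colors inside a window of $N-1$ integers, so the window
is filled. Bounds and injectivity thus suffice for the interval property. -/
theorem IsWindowColoring.exists_eq {N : ℕ} {w : ℕ → ℕ} {c : ℕ → ℕ → ℕ}
    (hc : IsWindowColoring N w c) {u k : ℕ} (hu : u < N) (h1 : w u < k) (h2 : k < w u + N) :
    ∃ v < N, u ≠ v ∧ c u v = k := by
  have hsub : ((range N).erase u).image (c u) ⊆ Ioo (w u) (w u + N) := by
    intro x hx
    simp only [mem_image, mem_erase, mem_range] at hx
    obtain ⟨v, ⟨hvu, hv⟩, rfl⟩ := hx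
    exact mem_Ioo.2 ⟨hc.lower u v hu hv hvu.symm, hc.upper u v hu hv hvu.symm⟩
  have hcard : (Ioo (w u) (w u + N)).card ≤ (((range N).erase u).image (c u)).card := by
    rw [card_image_of_injOn, card_erase_of_mem (mem_range.2 hu), card_range, Nat.card_Ioo]
    · omega
    · intro v hv v' hv' h
      simp only [coe_erase, Set.mem_sdiff, mem_coe, mem_range, Set.mem_singleton_iff] at hv hv'
      exact hc.inj u v v' hu hv.1 hv'.1 (Ne.symm hv.2) (Ne.symm hv'.2) h
  have hk : k ∈ ((range N).erase u).image (c u) := by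
    rw [eq_of_subset_of_card_le hsub hcard]; exact mem_Ioo.2 ⟨h1, h2⟩
  simp only [mem_image, mem_erase, mem_range] at hk
  obtain ⟨v, ⟨hvu, hv⟩, rfl⟩ := hk
  exact ⟨v, hv, hvu.symm, rfl⟩

theorem IsPairedShift.le {n M : ℕ} {w : ℕ → ℕ} (hw : IsPairedShift n M w) {u : ℕ}
    (hu : u < 2 * n) : w u ≤ M := by
  rw [← hw.last]
  exact hw.mono u _ (by omega) (by omega)

/-! ### Levels of colors and the product construction -/

/-- The thresholds of the levels: `levelShift m w s` is the color after which level `s` starts. -/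
def levelShift (m : ℕ) (w : ℕ → ℕ) (s : ℕ) : ℕ :=
  if s < m then w (2 * s) else w (2 * (s - m)) + (2 * m - 1)

theorem levelShift_of_lt {m s : ℕ} (w : ℕ → ℕ) (h : s < m) : levelShift m w s = w (2 * s) :=
  if_pos h

theorem levelShift_add (m : ℕ) (w : ℕ → ℕ) (s : ℕ) :
    levelShift m w (s + m) = w (2 * s) + (2 * m - 1) := by
  simp [levelShift]

/-- The two halves of the thresholds fit together because $M\le 2m-2<2m-1$. -/
theorem IsPairedShift.levelShift_mono {m M : ℕ} {w : ℕ → ℕ} (hw : IsPairedShift m M w)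
    {s t : ℕ} (hst : s ≤ t) (ht : t < 2 * m) : levelShift m w s ≤ levelShift m w t := by
  unfold levelShift
  have := hw.bound
  split_ifs with h1 h2 h2
  · exact hw.mono _ _ (by omega) (by omega)
  · have := hw.le (u := 2 * s) (by omega)
    omega
  · omega
  · have := hw.mono (2 * (s - m)) (2 * (t - m)) (by omega) (by omega)
    omega

/-- The number of levels that start before the color `k`. -/
def levelCount (m : ℕ) (w : ℕ → ℕ) (k : ℕ) : ℕ :=
  #{s ∈ range (2 * m) | levelShift m w s < k}

theorem levelCount_mono (m : ℕ) (w : ℕ → ℕ) {k l : ℕ} (h : k ≤ l) :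
    levelCount m w k ≤ levelCount m w l := by
  apply card_le_card
  intro s hs
  simp only [mem_filter] at hs ⊢
  exact ⟨hs.1, by omega⟩

theorem IsPairedShift.levelCount_le {m M : ℕ} {w : ℕ → ℕ} (hw : IsPairedShift m M w) {z k : ℕ}
    (h : k ≤ levelShift m w z) : levelCount m w k ≤ z := by
  conv_rhs => rw [← card_range z]
  apply card_le_card
  intro s hs
  simp only [mem_filter, mem_range] at hs ⊢
  by_contra hzs
  have := hw.levelShift_mono (not_lt.1 hzs) hs.1
  omega

theorem IsPairedShift.lt_levelCount {m M : ℕ} {w : ℕ → ℕ} (hw : IsPairedShift m M w) {z k : ℕ}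
    (hz : z < 2 * m) (h : levelShift m w z < k) : z + 1 ≤ levelCount m w k := by
  conv_lhs => rw [← card_range (z + 1)]
  apply card_le_card
  intro s hs
  simp only [mem_filter, mem_range] at hs ⊢
  have := hw.levelShift_mono (Nat.lt_succ_iff.1 hs) hz
  omega

/-- The color in level `z` at position `a`. -/
def levelColor (D m : ℕ) (w : ℕ → ℕ) (z a : ℕ) : ℕ := D * z + levelShift m w z + a

/-- The color obtained from `k` when gaps of length `D` are left at the starts of the levels. -/
def stretch (D m : ℕ) (w : ℕ → ℕ) (k : ℕ) : ℕ := k + D * levelCount m w k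

theorem stretch_injective (D m : ℕ) (w : ℕ → ℕ) : Function.Injective (stretch D m w) := by
  refine StrictMono.injective fun k l h => ?_
  have := Nat.mul_le_mul_left D (levelCount_mono m w h.le)
  unfold stretch
  omega

theorem IsPairedShift.levelColor_lt {m M : ℕ} {w : ℕ → ℕ} (hw : IsPairedShift m M w)
    {D z z' a a' : ℕ} (hz : z < z') (hz' : z' < 2 * m) (ha : a ≤ D) (ha' : 0 < a') :
    levelColor D m w z a < levelColor D m w z' a' := by
  have h1 := Nat.mul_le_mul_left D (Nat.succ_le_of_lt hz)
  have h2 := hw.levelShift_mono hz.le hz'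
  rw [Nat.succ_eq_add_one, mul_add, mul_one] at h1
  unfold levelColor
  omega

theorem IsPairedShift.levelColor_inj {m M : ℕ} {w : ℕ → ℕ} (hw : IsPairedShift m M w)
    {D z z' a a' : ℕ} (hz : z < 2 * m) (hz' : z' < 2 * m) (ha : 0 < a) (haD : a ≤ D)
    (ha' : 0 < a') (haD' : a' ≤ D) (h : levelColor D m w z a = levelColor D m w z' a') :
    z = z' ∧ a = a' := by
  rcases lt_trichotomy z z' with hlt | rfl | hlt
  · exact absurd h (hw.levelColor_lt hlt hz' haD ha').ne
  · unfold levelColor at h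
    omega
  · exact absurd h (hw.levelColor_lt hlt hz haD' ha).ne'

/-- Stretching moves a color past exactly the levels that start before it, so it lands either before
or after all $D$ places of level $z$. -/
theorem IsPairedShift.levelColor_ne_stretch {m M : ℕ} {w : ℕ → ℕ} (hw : IsPairedShift m M w)
    {D z a k : ℕ} (hz : z < 2 * m) (ha : 0 < a) (haD : a ≤ D) :
    levelColor D m w z a ≠ stretch D m w k := by
  unfold levelColor stretch
  rcases le_or_gt k (levelShift m w z) with h | h
  · have := Nat.mul_le_mul_left D (hw.levelCount_le h)
    omega
  · have := Nat.mul_le_mul_left D (hw.lt_levelCount hz h)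
    rw [mul_add, mul_one] at this
    omega

open Classical in
/-- `1` if the neighbor of `x` along the edge of color `k` is smaller than `x`, and `0` else. -/
noncomputable def orient (c : ℕ → ℕ → ℕ) (k x : ℕ) : ℕ := if ∃ y < x, c x y = k then 1 else 0

theorem orient_lt_two (c : ℕ → ℕ → ℕ) (k x : ℕ) : orient c k x < 2 := by
  unfold orient; split_ifs <;> omega

theorem IsWindowColoring.orient_add {N k : ℕ} {w : ℕ → ℕ} {c : ℕ → ℕ → ℕ}
    (hc : IsWindowColoring N w c) {x y : ℕ} (hx : x < N) (hy : y < N) (hxy : x ≠ y)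
    (h : c x y = k) : orient c k x + orient c k y = 1 := by
  wlog hlt : x < y generalizing x y
  · rw [add_comm]
    exact this hy hx hxy.symm (by rw [hc.symm y x hy hx, h]) (by omega)
  have h1 : orient c k y = 1 := if_pos ⟨x, hlt, by rw [hc.symm y x hy hx, h]⟩
  have h0 : orient c k x = 0 := by
    refine if_neg ?_
    rintro ⟨v, hv, hk⟩
    have := hc.inj x y v hx hy (by omega) hxy (by omega) (h.trans hk.symm)
    omega
  omega

/-- The color of the edge between `(x, i)` and `(y, j)` in the product of a coloring `c` of
`K_{2n}` and a coloring `c'` of `K_{2m}` with shift `w'`. -/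
noncomputable def productColor (n m : ℕ) (c : ℕ → ℕ → ℕ) (w' : ℕ → ℕ) (c' : ℕ → ℕ → ℕ)
    (x i y j : ℕ) : ℕ :=
  if x = y ∨ c x y = 2 * n - 1 then
    stretch (2 * n - 2) m w' (c' (2 * i + orient c (2 * n - 1) x) (2 * j + orient c (2 * n - 1) y))
  else if c x y < 2 * n - 1 then levelColor (2 * n - 2) m w' (i + j) (c x y)
  else levelColor (2 * n - 2) m w' (i + j + 1) (c x y - (2 * n - 1))

section product

variable {n m M M' : ℕ} {w w' : ℕ → ℕ} {c c' : ℕ → ℕ → ℕ}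

theorem productColor_comm (hc : IsWindowColoring (2 * n) w c)
    (hc' : IsWindowColoring (2 * m) w' c') {x i y j : ℕ} (hx : x < 2 * n) (hi : i < m)
    (hy : y < 2 * n) (hj : j < m) :
    productColor n m c w' c' x i y j = productColor n m c w' c' y j x i := by
  have hox := orient_lt_two c (2 * n - 1) x
  have hoy := orient_lt_two c (2 * n - 1) y
  unfold productColor
  rw [hc.symm y x hy hx, hc'.symm (2 * j + _) (2 * i + _) (by omega) (by omega)]
  simp only [add_comm j i, show (y = x) = (x = y) from propext eq_comm]

/-- The two kinds of colors that occur at `(x, i)`. -/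
theorem productColor_cases (hc : IsWindowColoring (2 * n) w c) (hw : IsPairedShift n M w)
    {x i y j : ℕ} (hx : x < 2 * n) (hy : y < 2 * n) (hj : j < m) (hne : x ≠ y ∨ i ≠ j) :
    (∃ v < 2 * m, 2 * i + orient c (2 * n - 1) x ≠ v ∧
      v = 2 * j + orient c (2 * n - 1) y ∧ (x = y ∨ x ≠ y ∧ c x y = 2 * n - 1) ∧
      productColor n m c w' c' x i y j =
        stretch (2 * n - 2) m w' (c' (2 * i + orient c (2 * n - 1) x) v)) ∨
    ∃ a e, x ≠ y ∧ 0 < a ∧ a ≤ 2 * n - 2 ∧ c x y = a + (2 * n - 1) * e ∧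
      (e = 0 ∧ w x < a ∨ e = 1 ∧ a ≤ w x) ∧
      productColor n m c w' c' x i y j = levelColor (2 * n - 2) m w' (i + j + e) a := by
  have hox := orient_lt_two c (2 * n - 1) x
  have hoy := orient_lt_two c (2 * n - 1) y
  unfold productColor
  split_ifs with h1 h2
  · left
    refine ⟨2 * j + orient c (2 * n - 1) y, by omega, ?_, rfl, ?_, rfl⟩
    · rcases eq_or_ne x y with rfl | hxy
      · have : i ≠ j := by simpa using hne
        omega
      · have := hc.orient_add hx hy hxy (h1.resolve_left hxy)
        omega
    · tauto
  · right
    push Not at h1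
    have := hc.lower x y hx hy h1.1
    exact ⟨c x y, 0, h1.1, by omega, by omega, by omega, by omega, rfl⟩
  · right
    push Not at h1
    have h3 := hc.upper x y hx hy h1.1
    have h4 := hw.le hx
    have h5 := hw.bound
    exact ⟨c x y - (2 * n - 1), 1, h1.1, by omega, by omega, by omega, by omega, rfl⟩

theorem productColor_mem (hc : IsWindowColoring (2 * n) w c) (hw : IsPairedShift n M w)
    (hc' : IsWindowColoring (2 * m) w' c') (hw' : IsPairedShift m M' w')
    {x i y j : ℕ} (hx : x < 2 * n) (hi : i < m)
    (hy : y < 2 * n) (hj : j < m) (hne : x ≠ y ∨ i ≠ j) :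
    w x + (2 * n - 2) * i + w' (2 * i) < productColor n m c w' c' x i y j ∧
    productColor n m c w' c' x i y j <
      w x + (2 * n - 2) * i + w' (2 * i) + ((2 * n - 2) * m + 2 * m) := by
  have hox := orient_lt_two c (2 * n - 1) x
  have hwx := hw.le hx
  have hb := hw.bound
  have hi0 : levelShift m w' i = w' (2 * i) := levelShift_of_lt w' hi
  have him : levelShift m w' (i + m) = w' (2 * i) + (2 * m - 1) := levelShift_add m w' i
  rcases productColor_cases (w' := w') (c' := c') hc hw hx hy hj hne with
    ⟨v, hv, huv, -, -, h⟩ | ⟨a, e, -, ha, haD, -, he, h⟩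
  · rw [h]
    -- The pairing of windows makes the start independent of which end of the matching edge $x$ is.
    have hu : w' (2 * i + orient c (2 * n - 1) x) = w' (2 * i) := by
      rcases Nat.le_one_iff_eq_zero_or_eq_one.1 (Nat.lt_succ_iff.1 hox) with h0 | h0
      · rw [h0, add_zero]
      · rw [h0, hw'.pair i hi]
    have h1 := hc'.lower _ v (by omega) hv huv
    have h2 := hc'.upper _ v (by omega) hv huv
    rw [hu] at h1 h2
    generalize c' (2 * i + orient c (2 * n - 1) x) v = k at *
    -- A color in the window of $2i$ comes after the start of level $i$ and not after that of level
    -- $i+m$.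
    have h3 := Nat.mul_le_mul_left (2 * n - 2) (hw'.lt_levelCount (z := i) (k := k) (by omega)
      (by omega))
    have h4 := Nat.mul_le_mul_left (2 * n - 2) (hw'.levelCount_le (z := i + m) (k := k) (by omega))
    unfold stretch
    rw [mul_add] at h3 h4
    omega
  · rw [h]
    unfold levelColor
    have h1 := Nat.mul_le_mul_left (2 * n - 2) (show i + e ≤ i + j + e by omega)
    have h3 := hw'.levelShift_mono (show i ≤ i + j + e by omega) (by omega)
    have h4 := hw'.levelShift_mono (show i + j + e ≤ i + m by omega) (by omega)
    have h2 := Nat.mul_le_mul_left (2 * n - 2) (show i + j + e + 1 ≤ i + m + e by omega)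
    have h5 : (2 * n - 2) * e = if e = 1 then 2 * n - 2 else 0 := by
      rcases he with ⟨rfl, -⟩ | ⟨rfl, -⟩ <;> simp
    simp only [mul_add, mul_one] at h1 h2 ⊢
    rw [h5] at h1 h2 ⊢
    split_ifs at h1 h2 ⊢ <;> omega

theorem productColor_inj (hc : IsWindowColoring (2 * n) w c) (hw : IsPairedShift n M w)
    (hc' : IsWindowColoring (2 * m) w' c') (hw' : IsPairedShift m M' w')
    {x i y j y' j' : ℕ} (hx : x < 2 * n) (hi : i < m)
    (hy : y < 2 * n) (hj : j < m) (hy' : y' < 2 * n) (hj' : j' < m)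
    (hne : x ≠ y ∨ i ≠ j) (hne' : x ≠ y' ∨ i ≠ j')
    (h : productColor n m c w' c' x i y j = productColor n m c w' c' x i y' j') :
    y = y' ∧ j = j' := by
  have hox := orient_lt_two c (2 * n - 1) x
  rcases productColor_cases (w' := w') (c' := c') hc hw hx hy hj hne with
    ⟨v, hv, huv, hvj, hxy, h1⟩ | ⟨a, e, hxy, ha, haD, hca, he, h1⟩ <;>
  rcases productColor_cases (w' := w') (c' := c') hc hw hx hy' hj' hne' with
    ⟨v', hv', huv', hvj', hxy', h2⟩ | ⟨a', e', hxy', ha', haD', hca', he', h2⟩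
  · have h3 := hc'.inj _ v v' (by omega) hv hv' huv huv'
      (stretch_injective _ _ _ (h1.symm.trans (h.trans h2)))
    have hoy := orient_lt_two c (2 * n - 1) y
    have hoy' := orient_lt_two c (2 * n - 1) y'
    refine ⟨?_, by omega⟩
    have ho : orient c (2 * n - 1) y = orient c (2 * n - 1) y' := by omega
    rcases hxy with rfl | ⟨hxy, hk⟩ <;> rcases hxy' with rfl | ⟨hxy', hk'⟩
    · rfl
    · have := hc.orient_add hx hy' hxy' hk'
      omega
    · have := hc.orient_add hx hy hxy hk
      omega
    · exact hc.inj x y y' hx hy hy' hxy hxy' (hk.trans hk'.symm)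
  · exact absurd (h2.symm.trans (h.symm.trans h1))
      (hw'.levelColor_ne_stretch (by omega) ha' haD')
  · exact absurd (h1.symm.trans (h.trans h2))
      (hw'.levelColor_ne_stretch (by omega) ha haD)
  · obtain ⟨hz, rfl⟩ := hw'.levelColor_inj (by omega) (by omega) ha haD ha' haD'
      (h1.symm.trans (h.trans h2))
    -- The place $a$ determines the lift $e$: at $x$, it is $0$ exactly when $a$ exceeds `w x`.
    have hee : e = e' := by omega
    subst hee
    exact ⟨hc.inj x y y' hx hy hy' hxy hxy' (hca.trans hca'.symm), by omega⟩

end product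

/-- The vertex $u$ stands for $(x,i)$ with $x=u \bmod 2n$ and $i=\lfloor u/2n\rfloor$. Its window
starts after place `w x` of level $i$; each full level contributes $2n-2$ colors. -/
theorem HasShift.mul {n m M M' : ℕ} (h : HasShift n M) (h' : HasShift m M') :
    HasShift (n * m) (M + M' + 2 * (n - 1) * (m - 1)) := by
  obtain ⟨w, c, hc, hw⟩ := h
  obtain ⟨w', c', hc', hw'⟩ := h'
  have hn := hw.pos
  have hm := hw'.pos
  have hb := hw.bound
  have hb' := hw'.bound
  have hmod : ∀ u, u % (2 * n) < 2 * n := fun u => Nat.mod_lt _ (by omega)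
  have hdiv : ∀ u, u < 2 * (n * m) → u / (2 * n) < m := fun u hu =>
    Nat.div_lt_of_lt_mul (by rw [mul_assoc]; exact hu)
  have hsplit : ∀ u v, u % (2 * n) = v % (2 * n) → u / (2 * n) = v / (2 * n) → u = v := by
    intro u v h1 h2
    rw [← Nat.div_add_mod u (2 * n), ← Nat.div_add_mod v (2 * n), h1, h2]
  have hne : ∀ u v, u ≠ v → u % (2 * n) ≠ v % (2 * n) ∨ u / (2 * n) ≠ v / (2 * n) := by
    intro u v huv
    by_contra! hcon
    exact huv (hsplit u v hcon.1 hcon.2)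
  have hD : (2 * n - 2) * m + 2 * m = 2 * (n * m) := by
    rw [← add_mul, Nat.sub_add_cancel (by omega), mul_assoc]
  refine ⟨fun u => w (u % (2 * n)) + (2 * n - 2) * (u / (2 * n)) + w' (2 * (u / (2 * n))),
    fun u v => productColor n m c w' c' (u % (2 * n)) (u / (2 * n)) (v % (2 * n)) (v / (2 * n)),
    ⟨?_, ?_, ?_, ?_⟩, ⟨?_, ?_, ?_, ?_, ?_, ?_⟩⟩
  · intro u v hu hv
    exact productColor_comm hc hc' (hmod u) (hdiv u hu) (hmod v) (hdiv v hv)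
  · intro u v hu hv huv
    exact (productColor_mem hc hw hc' hw' (hmod u) (hdiv u hu) (hmod v) (hdiv v hv)
      (hne u v huv)).1
  · intro u v hu hv huv
    have := (productColor_mem hc hw hc' hw' (hmod u) (hdiv u hu) (hmod v) (hdiv v hv)
      (hne u v huv)).2
    rwa [hD] at this
  · intro u v v' hu hv hv' huv huv' h
    obtain ⟨h1, h2⟩ := productColor_inj hc hw hc' hw' (hmod u) (hdiv u hu) (hmod v) (hdiv v hv)
      (hmod v') (hdiv v' hv') (hne u v huv) (hne u v' huv') h
    exact hsplit v v' h1 h2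
  · intro u v huv hv
    have h1 := Nat.div_le_div_right (c := 2 * n) huv
    have h2 := hw'.mono (2 * (u / (2 * n))) (2 * (v / (2 * n))) (by omega)
      (by have := hdiv v hv; omega)
    rcases h1.lt_or_eq with h3 | h3
    · have h4 := Nat.mul_le_mul_left (2 * n - 2) (Nat.succ_le_of_lt h3)
      rw [Nat.succ_eq_add_one, mul_add, mul_one] at h4
      have := hw.le (hmod u)
      omega
    · have h4 : u % (2 * n) ≤ v % (2 * n) := by
        have := Nat.div_add_mod u (2 * n)
        have := Nat.div_add_mod v (2 * n)
        rw [h3] at *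
        omega
      have := hw.mono _ _ h4 (hmod v)
      rw [h3]
      omega
  · intro q _
    have h1 : 2 * q / (2 * n) = q / n := Nat.mul_div_mul_left _ _ (by omega)
    have h2 : (2 * q + 1) / (2 * n) = q / n := by
      rw [← Nat.div_div_eq_div_mul]
      congr 1
      omega
    have h3 : 2 * q % (2 * n) = 2 * (q % n) := Nat.mul_mod_mul_left _ _ _
    have h4 : (2 * q + 1) % (2 * n) = 2 * (q % n) + 1 := by
      have e1 := Nat.div_add_mod (2 * q + 1) (2 * n)
      have e2 := Nat.div_add_mod (2 * q) (2 * n)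
      rw [h2] at e1
      rw [h1, h3] at e2
      omega
    rw [h1, h2, h3, h4, hw.pair _ (Nat.mod_lt _ hn)]
  · simp [hw.zero, hw'.zero]
  · have e : 2 * (n * m) - 1 = (2 * n - 1) + 2 * n * (m - 1) := by
      obtain ⟨k, rfl⟩ := Nat.exists_eq_add_of_lt hm
      rw [zero_add, Nat.add_sub_cancel]
      have : 2 * (n * (k + 1)) = 2 * n * k + 2 * n := by ring
      omega
    have h1 : (2 * (n * m) - 1) / (2 * n) = m - 1 := by
      rw [e, Nat.add_mul_div_left _ _ (by omega), Nat.div_eq_of_lt (by omega), zero_add]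
    have h2 : (2 * (n * m) - 1) % (2 * n) = 2 * n - 1 := by
      rw [e, Nat.add_mul_mod_self_left, Nat.mod_eq_of_lt (by omega)]
    have h3 : w' (2 * (m - 1)) = M' := by
      rw [hw'.pair _ (by omega), ← hw'.last]
      congr 1
      omega
    rw [h1, h2, h3, hw.last, Nat.mul_sub 2 n 1, mul_one]
    omega
  · exact Nat.mul_pos hn hm
  · obtain ⟨a, rfl⟩ := Nat.exists_eq_add_of_lt hn
    obtain ⟨b, rfl⟩ := Nat.exists_eq_add_of_lt hm
    have : 2 * ((0 + a + 1) * (0 + b + 1)) = 2 * a * b + 2 * a + 2 * b + 2 := by ring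
    simp only [zero_add, Nat.add_sub_cancel] at *
    omega

/-! ### An explicit coloring of $K_{4a+2}$ with $7a$ colors -/

/-- A quantity given by different formulas for `s < a - 1`, `s = a - 1` and `s ≥ a`. -/
def piece (a s l m h : ℕ) : ℕ := if s + 1 < a then l else if s + 1 = a then m else h

theorem piece_cases (a s l m h : ℕ) :
    (s + 1 < a ∧ piece a s l m h = l) ∨ (s + 1 = a ∧ piece a s l m h = m) ∨
      (a ≤ s ∧ piece a s l m h = h) := by
  unfold piece
  split_ifs <;> omega

/-- The color of an edge between a vertex of type `x` in block `i` and one of type `y ≥ x` in block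
`j`, in the coloring of the complete graph with `4a + 2` vertices, `a` blocks of four vertices of
types `0, ..., 3` and two further vertices of types `4` and `5`. -/
def upperColor (a i j : ℕ) : ℕ → ℕ → ℕ
  | 0, 0 => piece a (i + j) (3 * (i + j) + 1) (4 * a - 1) (3 * (i + j) + a + 1)
  | 0, 1 => piece a (i + j) (if i = j then 3 * (i + j) + 1 else 3 * a + (i + j)) (3 * a - 2)
      (i + j + 2 * a)
  | 0, 2 => piece a (i + j) (3 * (i + j) + if i = j then 2 else 3) (3 * a - 1)
      (3 * (i + j) + a + 2)
  | 0, 3 => piece a (i + j) (3 * (i + j) + if i = j then 3 else 2) (4 * a)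
      (3 * (i + j) + a + 3)
  | 1, 1 => piece a (i + j) (3 * (i + j) + 1) (4 * a - 1) (3 * (i + j) + a)
  | 1, 2 => piece a (i + j) (3 * (i + j) + if i = j then 3 else 2) (4 * a + 1)
      (3 * (i + j) + a + 4)
  | 1, 3 => piece a (i + j) (3 * (i + j) + if i = j then 2 else 3) (3 * a - 1)
      (3 * (i + j) + a + 2)
  | 2, 2 => piece a (i + j) (3 * a + (i + j) + 1) (4 * a) (3 * (i + j) + a + 3)
  | 2, 3 => piece a (i + j) (3 * (i + j) + 4) (3 * a) (i + j + 2 * a + 1)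
  | 3, 3 => piece a (i + j) (3 * a + (i + j) + 1) (4 * a + 1) (3 * (i + j) + a + 4)
  | 0, 4 => if 2 * i < a then 3 * a + 2 * i else 6 * i + a + 1
  | 1, 4 => 4 * a + 3 * i
  | 2, 4 => if 2 * i + 1 < a then 3 * a + 2 * i + 1 else 4 * a + 3 * i + 2
  | 3, 4 => if 2 * i + 1 < a then 4 * a + 3 * i + 2 else 6 * i + a + 4
  | 0, 5 => 4 * a + 3 * i + 1
  | 1, 5 => if 2 * i < a then 3 * a + 2 * i else 6 * i + a
  | 2, 5 => if 2 * i + 1 < a then 4 * a + 3 * i + 2 else 6 * i + a + 3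
  | 3, 5 => if 2 * i + 1 < a then 3 * a + 2 * i + 1 else 4 * a + 3 * i + 2
  -- The only edge left joins the two extra vertices and gets the top color.
  | _, _ => 7 * a

/-- The color of an edge between a vertex of type `x` in block `i` and one of type `y` in
block `j`. -/
def typeColor (a x i y j : ℕ) : ℕ := if x ≤ y then upperColor a i j x y else upperColor a j i y x

/-- The start of the window of colors at a vertex of type `x` in block `i`. -/
def typeShift (a x i : ℕ) : ℕ := if x < 4 then 3 * i + x / 2 else 3 * a - 1

/-- The pairs of a type `x` and a block `i` that occur. -/
def IsType (a x i : ℕ) : Prop := x < 4 ∧ i < a ∨ (x = 4 ∨ x = 5) ∧ i = a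

theorem typeColor_comm {a x i y j : ℕ} : typeColor a x i y j = typeColor a y j x i := by
  unfold typeColor
  rcases lt_trichotomy x y with h | rfl | h
  · rw [if_pos h.le, if_neg (by omega)]
  · simp only [le_refl, if_true]
    unfold upperColor
    split <;> simp only [add_comm j i]
  · rw [if_pos h.le, if_neg (by omega)]

theorem typeColor_mem {a x i y j : ℕ} (ha : 0 < a) (hx : IsType a x i) (hy : IsType a y j)
    (hne : x ≠ y ∨ i ≠ j) :
    typeShift a x i < typeColor a x i y j ∧
      typeColor a x i y j < typeShift a x i + (4 * a + 2) := by
  have hx6 : x < 6 := by unfold IsType at hx; omega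
  have hy6 : y < 6 := by unfold IsType at hy; omega
  unfold IsType at hx hy
  interval_cases x <;> interval_cases y <;>
    simp only [typeColor, typeShift, upperColor, piece, Nat.reduceLeDiff, Nat.reduceLT,
      Nat.reduceDiv, le_refl, zero_le, if_true, if_false] <;>
    (try split_ifs) <;> omega

-- For fixed types the colors are piecewise linear in $a$ and the blocks, so each case is linear
-- arithmetic.
set_option maxHeartbeats 8000000 in
theorem typeColor_inj {a x i y j y' j' : ℕ} (ha : 0 < a) (hx : IsType a x i) (hy : IsType a y j)
    (hy' : IsType a y' j') (hne : x ≠ y ∨ i ≠ j) (hne' : x ≠ y' ∨ i ≠ j')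
    (h : typeColor a x i y j = typeColor a x i y' j') : y = y' ∧ j = j' := by
  wlog hyy : y ≤ y' generalizing y j y' j'
  · obtain ⟨h1, h2⟩ := this hy' hy hne' hne h.symm (by omega)
    exact ⟨h1.symm, h2.symm⟩
  have hx6 : x < 6 := by unfold IsType at hx; omega
  have hy6 : y < 6 := by unfold IsType at hy; omega
  have hy6' : y' < 6 := by unfold IsType at hy'; omega
  unfold IsType at hx hy hy'
  interval_cases x <;> interval_cases y <;> interval_cases y' <;>
    simp only [typeColor, upperColor, piece, Nat.reduceLeDiff, le_refl, zero_le, if_true,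
      if_false] at h <;>
    (try split_ifs at h) <;> omega

theorem hasShift_odd {a : ℕ} (ha : 0 < a) : HasShift (2 * a + 1) (3 * a - 1) := by
  let τ : ℕ → ℕ := fun u => if u < 4 * a then u % 4 else u % 4 + 4
  have hτ : ∀ u, u < 2 * (2 * a + 1) → IsType a (τ u) (u / 4) := by
    intro u hu
    simp only [IsType, τ]
    split_ifs <;> omega
  have hsplit : ∀ u v, u < 2 * (2 * a + 1) → v < 2 * (2 * a + 1) → τ u = τ v → u / 4 = v / 4 →
      u = v := by
    intro u v hu hv h1 h2
    simp only [τ] at h1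
    split_ifs at h1 <;> omega
  have hne : ∀ u v, u < 2 * (2 * a + 1) → v < 2 * (2 * a + 1) → u ≠ v →
      τ u ≠ τ v ∨ u / 4 ≠ v / 4 := by
    intro u v hu hv huv
    by_contra! hcon
    exact huv (hsplit u v hu hv hcon.1 hcon.2)
  have hN : 4 * a + 2 = 2 * (2 * a + 1) := by ring
  refine ⟨fun u => typeShift a (τ u) (u / 4), fun u v => typeColor a (τ u) (u / 4) (τ v) (v / 4),
    ⟨?_, ?_, ?_, ?_⟩, ⟨?_, ?_, ?_, ?_, ?_, ?_⟩⟩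
  · exact fun u v _ _ => typeColor_comm
  · exact fun u v hu hv huv => (typeColor_mem ha (hτ u hu) (hτ v hv) (hne u v hu hv huv)).1
  · intro u v hu hv huv
    rw [← hN]
    exact (typeColor_mem ha (hτ u hu) (hτ v hv) (hne u v hu hv huv)).2
  · intro u v v' hu hv hv' huv huv' h
    obtain ⟨h1, h2⟩ := typeColor_inj ha (hτ u hu) (hτ v hv) (hτ v' hv') (hne u v hu hv huv)
      (hne u v' hu hv' huv') h
    exact hsplit v v' hv hv' h1 h2
  · intro u v huv hv
    simp only [typeShift, τ]
    split_ifs <;> omega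
  · intro q hq
    simp only [typeShift, τ]
    split_ifs <;> omega
  · simp [typeShift, τ, ha]
  · simp only [typeShift, τ]
    split_ifs <;> omega
  · omega
  · omega

/-! ### Base colorings of $K_2$, $K_4$ and $K_{22}$ -/

theorem hasShift_one : HasShift 1 0 := by
  refine ⟨fun _ => 0, fun _ _ => 1, ⟨?_, ?_, ?_, ?_⟩, ⟨?_, ?_, ?_, ?_, ?_, ?_⟩⟩ <;> intros <;> omega

/-- The symmetric function whose values below the diagonal are given by the rows of a table. -/
def tableColor (t : List (List ℕ)) (u v : ℕ) : ℕ := (t.getD (max u v) []).getD (min u v) 0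

theorem tableColor_comm (t : List (List ℕ)) (u v : ℕ) : tableColor t u v = tableColor t v u := by
  rw [tableColor, max_comm, min_comm, tableColor]

theorem isWindowColoring_tableColor {N : ℕ} {w : ℕ → ℕ} {t : List (List ℕ)}
    (h : ∀ u < N, ∀ v < N, u = v ∨ w u < tableColor t u v ∧ tableColor t u v < w u + N ∧
      ∀ v' < v, u = v' ∨ tableColor t u v ≠ tableColor t u v') :
    IsWindowColoring N w (tableColor t) where
  symm u v _ _ := tableColor_comm t u v
  lower u v hu hv huv := ((h u hu v hv).resolve_left huv).1
  upper u v hu hv huv := ((h u hu v hv).resolve_left huv).2.1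
  inj u v v' hu hv hv' huv huv' he := by
    rcases lt_trichotomy v v' with hlt | rfl | hlt
    · exact absurd he.symm ((((h u hu v' hv').resolve_left huv').2.2 v hlt).resolve_left huv)
    · rfl
    · exact absurd he ((((h u hu v hv).resolve_left huv).2.2 v' hlt).resolve_left huv')

theorem hasShift_two : HasShift 2 1 := by
  refine ⟨fun u => [0, 0, 1, 1].getD u 0, tableColor [[], [1], [2, 3], [3, 2, 4]],
    isWindowColoring_tableColor (by decide), ⟨?_, ?_, ?_, ?_, ?_, ?_⟩⟩
  · intro u v huv hv
    have : ∀ v < 4, ∀ u ≤ v, [0, 0, 1, 1].getD u 0 ≤ [0, 0, 1, 1].getD v 0 := by decide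
    exact this v hv u huv
  all_goals decide

/-- The colors below the diagonal of a coloring of `K_22` with `37` colors. -/
def table22 : List (List ℕ) :=
  [
    [],
    [1],
    [2, 3],
    [3, 2, 4],
    [6, 4, 5, 7],
    [4, 5, 7, 6, 8],
    [7, 6, 8, 5, 9, 10],
    [5, 7, 6, 8, 12, 9, 11],
    [9, 8, 10, 12, 11, 14, 16, 13],
    [8, 9, 12, 13, 15, 11, 14, 10, 19],
    [13, 11, 9, 14, 10, 17, 12, 21, 15, 24],
    [12, 10, 11, 9, 21, 13, 19, 15, 20, 16, 18],
    [10, 12, 20, 11, 14, 15, 13, 16, 18, 17, 19, 22],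
    [11, 18, 16, 10, 13, 12, 15, 17, 22, 21, 20, 14, 23],
    [18, 16, 13, 15, 19, 20, 17, 14, 24, 22, 23, 25, 21, 27],
    [15, 13, 14, 16, 17, 23, 20, 22, 21, 18, 26, 24, 25, 19, 28],
    [14, 15, 22, 17, 16, 19, 21, 18, 26, 20, 25, 23, 24, 28, 29, 27],
    [16, 14, 15, 21, 20, 24, 18, 19, 23, 27, 22, 17, 28, 25, 26, 29, 30],
    [21, 19, 18, 22, 24, 16, 23, 20, 17, 25, 29, 28, 27, 26, 30, 33, 31, 32],
    [19, 17, 21, 20, 23, 18, 22, 24, 25, 28, 16, 27, 26, 29, 32, 30, 33, 31, 34],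
    [20, 21, 17, 19, 18, 22, 24, 25, 27, 23, 28, 26, 29, 30, 33, 31, 32, 34, 35, 36],
    [17, 20, 19, 18, 22, 21, 25, 23, 28, 26, 27, 29, 30, 24, 31, 32, 34, 33, 36, 35, 37]]

/-- The starts of the windows of colors in `table22`. -/
def shift22 : List ℕ :=
  [0, 0, 1, 1, 3, 3, 4, 4, 7, 7, 8, 8, 9, 9, 12, 12, 13, 13, 15, 15, 16, 16]

set_option maxRecDepth 100000 in
theorem hasShift_eleven : HasShift 11 16 := by
  refine ⟨fun u => shift22.getD u 0, tableColor table22,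
    isWindowColoring_tableColor (by decide +kernel), ⟨?_, ?_, ?_, ?_, ?_, ?_⟩⟩
  · intro u v huv hv
    have : ∀ v < 22, ∀ u ≤ v, shift22.getD u 0 ≤ shift22.getD v 0 := by decide +kernel
    exact this v hv u huv
  all_goals decide

/-! ### Interval colorings of regular graphs and their Cartesian products -/

/-- `c` is an interval `t`-coloring of the `r`-regular graph `G`, with the colors at the vertex `u`
being the `r` integers that follow `s u`. -/
structure IsRegularColoring {V : Type*} (G : SimpleGraph V) (r t : ℕ) (s : V → ℕ)
    (c : V → V → ℕ) : Prop where
  symm : ∀ u v, c u v = c v u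
  lower : ∀ u v, G.Adj u v → s u < c u v
  upper : ∀ u v, G.Adj u v → c u v ≤ s u + r
  inj : ∀ u v v', G.Adj u v → G.Adj u v' → c u v = c u v' → v = v'
  surj : ∀ u k, s u < k → k ≤ s u + r → ∃ v, G.Adj u v ∧ c u v = k
  bot : ∃ u, s u = 0
  top : ∃ u, s u + r = t
  le_top : ∀ u, s u + r ≤ t
  cover : ∀ k, 0 < k → k ≤ t → ∃ u v, G.Adj u v ∧ c u v = k

theorem IsRegularColoring.mem_colorCounts {V : Type*} {G : SimpleGraph V} {r t : ℕ} {s : V → ℕ}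
    {c : V → V → ℕ} (h : IsRegularColoring G r t s c) (ht : 0 < t) : t ∈ colorCounts G := by
  have himage : ∀ v, Sym2.lift ⟨c, h.symm⟩ '' G.incidenceSet v = Set.Icc (s v + 1) (s v + r) := by
    intro v
    ext k
    constructor
    · rintro ⟨e, ⟨he, hv⟩, rfl⟩
      obtain ⟨x, rfl⟩ := Sym2.mem_iff_exists.1 hv
      exact ⟨h.lower v x he, h.upper v x he⟩
    · rintro ⟨h1, h2⟩
      obtain ⟨x, hx, rfl⟩ := h.surj v k h1 h2
      exact ⟨s(v, x), ⟨hx, Sym2.mem_mk_left v x⟩, rfl⟩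
  refine ⟨ht, Sym2.lift ⟨c, h.symm⟩, ?_, ?_, ?_⟩
  · ext k
    constructor
    · rintro ⟨e, he, rfl⟩
      induction e using Sym2.ind with
      | _ u v =>
        have := h.lower u v he
        have := h.upper u v he
        have := h.le_top u
        simp only [Sym2.lift_mk, Set.mem_Icc]
        omega
    · rintro ⟨h1, h2⟩
      obtain ⟨u, v, huv, rfl⟩ := h.cover k h1 h2
      exact ⟨s(u, v), huv, rfl⟩
  · rintro v e ⟨he, hv⟩ e' ⟨he', hv'⟩ heq
    obtain ⟨x, rfl⟩ := Sym2.mem_iff_exists.1 hv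
    obtain ⟨y, rfl⟩ := Sym2.mem_iff_exists.1 hv'
    rw [h.inj v x y he he' heq]
  · intro v
    rw [himage]
    exact Set.ordConnected_Icc

theorem IsRegularColoring.comap {V V' : Type*} {G : SimpleGraph V} {G' : SimpleGraph V'}
    {r t : ℕ} {s : V → ℕ} {c : V → V → ℕ} (h : IsRegularColoring G r t s c) (e : G' ≃g G) :
    IsRegularColoring G' r t (fun u => s (e u)) (fun u v => c (e u) (e v)) where
  symm u v := h.symm _ _
  lower u v huv := h.lower _ _ (e.map_adj_iff.2 huv)
  upper u v huv := h.upper _ _ (e.map_adj_iff.2 huv)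
  inj u v v' huv huv' heq :=
    e.injective (h.inj _ _ _ (e.map_adj_iff.2 huv) (e.map_adj_iff.2 huv') heq)
  surj u k h1 h2 := by
    obtain ⟨v, hv, hk⟩ := h.surj _ k h1 h2
    refine ⟨e.symm v, e.map_adj_iff.1 ?_, ?_⟩ <;> simpa
  bot := by
    obtain ⟨u, hu⟩ := h.bot
    exact ⟨e.symm u, by simpa⟩
  top := by
    obtain ⟨u, hu⟩ := h.top
    exact ⟨e.symm u, by simpa⟩
  le_top u := h.le_top _
  cover k h1 h2 := by
    obtain ⟨u, v, hv, hk⟩ := h.cover k h1 h2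
    refine ⟨e.symm u, e.symm v, e.map_adj_iff.1 ?_, ?_⟩ <;> simpa

open Classical in
/-- A color for the edges of `G □ H`: on the edges inside a copy of `G` the coloring `c` is shifted
so that its colors come before those of the edges inside the copy of `H`, except in the copy of `G`
at the vertex `z`, where they come after them. -/
noncomputable def boxColor {V V' : Type*} (r d : ℕ) (z : V') (s : V → ℕ) (c : V → V → ℕ)
    (s' : V' → ℕ) (c' : V' → V' → ℕ) (p q : V × V') : ℕ :=
  if p.1 = q.1 then c' p.2 q.2 + s p.1 + r
  else c p.1 q.1 + s' p.2 + if p.2 = z then d + r else 0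

open Classical in
/-- The Cartesian product of an `r`-regular graph with an interval `t`-coloring and a `d`-regular
graph with an interval `t'`-coloring has an interval coloring with `t + t' + r` colors. -/
theorem IsRegularColoring.boxProd {V V' : Type*} {G : SimpleGraph V} {H : SimpleGraph V'}
    {r t d t' : ℕ} {s : V → ℕ} {c : V → V → ℕ} {s' : V' → ℕ} {c' : V' → V' → ℕ}
    (h : IsRegularColoring G r t s c) (h' : IsRegularColoring H d t' s' c')
    {y z : V'} (hy : s' y = 0) (hz : s' z + d = t') (hyz : y ≠ z) :
    ∃ s'' c'', IsRegularColoring (G □ H) (r + d) (t + t' + r) s'' c'' := by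
  have hG : ∀ {u u' : V} (v : V'), G.Adj u u' →
      boxColor r d z s c s' c' (u, v) (u', v) = c u u' + s' v + if v = z then d + r else 0 :=
    fun v huu => if_neg huu.ne
  have hH : ∀ (u : V) (v v' : V'),
      boxColor r d z s c s' c' (u, v) (u, v') = c' v v' + s u + r := fun u v v' => if_pos rfl
  -- At `z` the edges of `G` come last, which raises the start by `r`. The value 0 off the edges is
  -- needed because `boxColor` need not be symmetric there.
  refine ⟨fun p => s p.1 + s' p.2 + if p.2 = z then r else 0, fun p q =>
    if (G □ H).Adj p q then boxColor r d z s c s' c' p q else 0, ?_, ?_, ?_, ?_, ?_, ?_, ?_, ?_, ?_⟩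
  · rintro ⟨u, v⟩ ⟨u', v'⟩
    simp only [SimpleGraph.adj_comm (G □ H) (u', v')]
    split_ifs with hadj
    · rcases SimpleGraph.boxProd_adj.1 hadj with ⟨hu : G.Adj u u', rfl : v = v'⟩ | ⟨hv : H.Adj v v', rfl : u = u'⟩
      · rw [hG v hu, hG v hu.symm, h.symm]
      · rw [hH, hH, h'.symm]
    · rfl
  · rintro ⟨u, v⟩ ⟨u', v'⟩ hadj
    simp only [if_pos hadj]
    rcases SimpleGraph.boxProd_adj.1 hadj with ⟨hu : G.Adj u u', rfl : v = v'⟩ | ⟨hv : H.Adj v v', rfl : u = u'⟩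
    · have := h.lower u u' hu
      rw [hG v hu]
      split_ifs <;> omega
    · have := h'.lower v v' hv
      rw [hH]
      split_ifs <;> omega
  · rintro ⟨u, v⟩ ⟨u', v'⟩ hadj
    simp only [if_pos hadj]
    rcases SimpleGraph.boxProd_adj.1 hadj with ⟨hu : G.Adj u u', rfl : v = v'⟩ | ⟨hv : H.Adj v v', rfl : u = u'⟩
    · have := h.upper u u' hu
      rw [hG v hu]
      split_ifs <;> omega
    · have := h'.upper v v' hv
      rw [hH]
      split_ifs <;> omega
  · rintro ⟨u, v⟩ ⟨u₁, v₁⟩ ⟨u₂, v₂⟩ h1 h2 heq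
    simp only [if_pos h1, if_pos h2] at heq
    rcases SimpleGraph.boxProd_adj.1 h1 with
      ⟨hu : G.Adj u u₁, rfl : v = v₁⟩ | ⟨hv : H.Adj v v₁, rfl : u = u₁⟩ <;>
    rcases SimpleGraph.boxProd_adj.1 h2 with
      ⟨hu' : G.Adj u u₂, rfl : v = v₂⟩ | ⟨hv' : H.Adj v v₂, rfl : u = u₂⟩
    · rw [hG v hu, hG v hu'] at heq
      rw [h.inj u u₁ u₂ hu hu' (by omega)]
    · rw [hG v hu, hH] at heq
      have := h.lower u u₁ hu
      have := h.upper u u₁ hu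
      have := h'.lower v v₂ hv'
      have := h'.upper v v₂ hv'
      split_ifs at heq <;> omega
    · rw [hG v hu', hH] at heq
      have := h.lower u u₂ hu'
      have := h.upper u u₂ hu'
      have := h'.lower v v₁ hv
      have := h'.upper v v₁ hv
      split_ifs at heq <;> omega
    · rw [hH, hH] at heq
      rw [h'.inj v v₁ v₂ hv hv' (by omega)]
  · rintro ⟨u, v⟩ k h1 h2
    have key : (∃ u', G.Adj u u' ∧ c u u' + s' v + (if v = z then d + r else 0) = k) ∨
        ∃ v', H.Adj v v' ∧ c' v v' + s u + r = k := by
      dsimp only at h1 h2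
      split_ifs at h1 h2 ⊢
      · rcases le_or_gt k (s u + s' v + r + d) with hk | hk
        · obtain ⟨v', hv, hc⟩ := h'.surj v (k - s u - r) (by omega) (by omega)
          exact Or.inr ⟨v', hv, by omega⟩
        · obtain ⟨u', hu, hc⟩ := h.surj u (k - s' v - d - r) (by omega) (by omega)
          exact Or.inl ⟨u', hu, by omega⟩
      · rcases le_or_gt k (s u + s' v + r) with hk | hk
        · obtain ⟨u', hu, hc⟩ := h.surj u (k - s' v) (by omega) (by omega)
          exact Or.inl ⟨u', hu, by omega⟩
        · obtain ⟨v', hv, hc⟩ := h'.surj v (k - s u - r) (by omega) (by omega)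
          exact Or.inr ⟨v', hv, by omega⟩
    rcases key with ⟨u', hu, hk⟩ | ⟨v', hv, hk⟩
    · have hadj : (G □ H).Adj (u, v) (u', v) := SimpleGraph.boxProd_adj.2 (Or.inl ⟨hu, rfl⟩)
      exact ⟨(u', v), hadj, by rw [if_pos hadj, hG v hu, hk]⟩
    · have hadj : (G □ H).Adj (u, v) (u, v') := SimpleGraph.boxProd_adj.2 (Or.inr ⟨hv, rfl⟩)
      exact ⟨(u, v'), hadj, by rw [if_pos hadj, hH, hk]⟩
  · obtain ⟨u, hu⟩ := h.bot
    exact ⟨(u, y), by simp [hu, hy, hyz]⟩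
  · obtain ⟨u, hu⟩ := h.top
    refine ⟨(u, z), ?_⟩
    simp only [if_true]
    omega
  · rintro ⟨u, v⟩
    have := h.le_top u
    have := h'.le_top v
    dsimp only
    split_ifs <;> omega
  · intro k h1 h2
    obtain ⟨u, hu⟩ := h.top
    -- Three ranges: the copy of `G` at `y`, the copy of `H` at a vertex with top window, and the
    -- copy of `G` at `z`.
    rcases le_or_gt k t with hk | hk
    · obtain ⟨u, u', huu, hc⟩ := h.cover k h1 hk
      have hadj : (G □ H).Adj (u, y) (u', y) := SimpleGraph.boxProd_adj.2 (Or.inl ⟨huu, rfl⟩)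
      exact ⟨(u, y), (u', y), hadj, by rw [if_pos hadj, hG y huu, if_neg hyz, hc, hy]; rfl⟩
    rcases le_or_gt k (t + t') with hk' | hk'
    · obtain ⟨v, v', hv, hc⟩ := h'.cover (k - t) (by omega) (by omega)
      have hadj : (G □ H).Adj (u, v) (u, v') := SimpleGraph.boxProd_adj.2 (Or.inr ⟨hv, rfl⟩)
      exact ⟨(u, v), (u, v'), hadj, by rw [if_pos hadj, hH, hc]; omega⟩
    · obtain ⟨u', huu, hc⟩ := h.surj u (k - t' - r) (by omega) (by omega)
      have hadj : (G □ H).Adj (u, z) (u', z) := SimpleGraph.boxProd_adj.2 (Or.inl ⟨huu, rfl⟩)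
      exact ⟨(u, z), (u', z), hadj, by rw [if_pos hadj, hG z huu, if_pos rfl, hc]; omega⟩

/-! ### Colorings of complete graphs and Hamming graphs -/

/-- The Hamming graph of dimension `k + 1` as a Cartesian product. -/
def hammingGraphSucc (m k : ℕ) :
    hammingGraph m (k + 1) ≃g hammingGraph m k □ (⊤ : SimpleGraph (Fin m)) where
  toEquiv := (Fin.consEquiv fun _ => Fin m).symm.trans (Equiv.prodComm _ _)
  map_rel_iff' := by
    intro x y
    simp only [hammingGraph, cartesianProduct, SimpleGraph.boxProd_adj, Equiv.trans_apply,
      Equiv.prodComm_apply, Fin.consEquiv_symm_apply, Prod.fst_swap, Prod.snd_swap]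
    rw [Fin.exists_fin_succ]
    simp only [Fin.forall_fin_succ, ne_eq, not_true_eq_false, false_implies, true_and,
      Fin.succ_ne_zero, (Fin.succ_ne_zero _).symm, not_false_eq_true, true_implies,
      Fin.succ_inj, funext_iff]
    simp only [Fin.tail]
    constructor
    · rintro (⟨⟨i, h1, h2⟩, h3⟩ | ⟨h1, h2⟩)
      · exact Or.inr ⟨i, h1, h3, h2⟩
      · exact Or.inl ⟨h1, h2⟩
    · rintro (⟨h1, h2⟩ | ⟨i, h1, h3, h2⟩)
      · exact Or.inr ⟨h1, h2⟩
      · exact Or.inl ⟨⟨i, h1, h2⟩, h3⟩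

/-- A coloring of `K_{2n}` whose windows start at positions that vary from `0` to `M`, as a coloring
of the complete graph. -/
theorem HasShift.exists_isRegularColoring {n M : ℕ} (h : HasShift n M) :
    ∃ s c, ∃ y z : Fin (2 * n),
      IsRegularColoring (⊤ : SimpleGraph (Fin (2 * n))) (2 * n - 1) (M + (2 * n - 1)) s c ∧
      s y = 0 ∧ s z = M ∧ y ≠ z := by
  obtain ⟨w, c, hc, hw⟩ := h
  have hn := hw.pos
  have hb := hw.bound
  refine ⟨fun u => w u, fun u v => c u v, ⟨0, by omega⟩, ⟨2 * n - 1, by omega⟩,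
    ⟨?_, ?_, ?_, ?_, ?_, ?_, ?_, ?_, ?_⟩, hw.zero, hw.last, ?_⟩
  · exact fun u v => hc.symm u v u.2 v.2
  · exact fun u v huv => hc.lower u v u.2 v.2 (Fin.val_ne_of_ne huv)
  · intro u v huv
    have := hc.upper u v u.2 v.2 (Fin.val_ne_of_ne huv)
    omega
  · exact fun u v v' huv huv' heq => Fin.ext
      (hc.inj u v v' u.2 v.2 v'.2 (Fin.val_ne_of_ne huv) (Fin.val_ne_of_ne huv') heq)
  · intro u k h1 h2
    obtain ⟨v, hv, huv, hk⟩ := hc.exists_eq u.2 h1 (by omega)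
    exact ⟨⟨v, hv⟩, fun he => huv (congrArg Fin.val he), hk⟩
  · exact ⟨⟨0, by omega⟩, hw.zero⟩
  · exact ⟨⟨2 * n - 1, by omega⟩, by simp only [hw.last]⟩
  · exact fun u => Nat.add_le_add_right (hw.le u.2) _
  · intro k h1 h2
    -- The first and last windows cover all colors, since $M\le 2n-2$.
    rcases lt_or_ge k (2 * n) with hk | hk
    · obtain ⟨v, hv, huv, hk⟩ := hc.exists_eq (u := 0) (k := k) (by omega)
        (by rw [hw.zero]; omega) (by rw [hw.zero]; omega)
      exact ⟨⟨0, by omega⟩, ⟨v, hv⟩, fun he => huv (congrArg Fin.val he), hk⟩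
    · obtain ⟨v, hv, huv, hk⟩ := hc.exists_eq (u := 2 * n - 1) (k := k) (by omega)
        (by rw [hw.last]; omega) (by rw [hw.last]; omega)
      exact ⟨⟨2 * n - 1, by omega⟩, ⟨v, hv⟩, fun he => huv (congrArg Fin.val he), hk⟩
  · intro he
    have := congrArg Fin.val he
    dsimp only at this
    omega

theorem HasShift.exists_hammingGraph {n M : ℕ} (h : HasShift n M) (k : ℕ) :
    ∃ t s c, IsRegularColoring (hammingGraph (2 * n) k) (k * (2 * n - 1)) t s c ∧
      (t : ℚ) = (M + (2 * n - 1)) * k + 1 / 2 * k * (k - 1) * (2 * n - 1) := by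
  obtain ⟨s', c', y, z, h', hy, hz, hyz⟩ := h.exists_isRegularColoring
  have hn : 1 ≤ 2 * n := by have := y.2; omega
  induction k with
  | zero =>
    refine ⟨0, fun _ => 0, fun _ _ => 0, ⟨?_, ?_, ?_, ?_, ?_, ?_, ?_, ?_, ?_⟩, by simp⟩
    · simp
    · rintro u v ⟨i, -⟩
      exact i.elim0
    · simp
    · rintro u v v' ⟨i, -⟩
      exact i.elim0
    · intro u k h1 h2
      omega
    · exact ⟨Fin.elim0, rfl⟩
    · exact ⟨Fin.elim0, by simp⟩
    · simp
    · intro k h1 h2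
      omega
  | succ k ih =>
    obtain ⟨t, s, c, ht, hk⟩ := ih
    obtain ⟨s'', c'', h''⟩ := ht.boxProd h' hy (by rw [hz]) hyz
    rw [← Nat.succ_mul] at h''
    refine ⟨_, _, _, h''.comap (hammingGraphSucc (2 * n) k), ?_⟩
    push_cast [hn]
    rw [hk]
    ring

/-! ### Defects and the prime factorization -/

/-- The complete graph `K_{2n}` has an interval coloring with `4n - 3 - f` colors, of the kind that
`HasShift` describes, and `f` is at most `p + q - 1` where `n = p 2^q` with `p` odd. -/
def HasDefect (n f : ℕ) : Prop :=
  (∃ M, M + f + 2 = 2 * n ∧ HasShift n M) ∧ ∃ p q, Odd p ∧ n = p * 2 ^ q ∧ f + 1 ≤ p + q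

theorem hasDefect_one : HasDefect 1 0 :=
  ⟨⟨0, rfl, hasShift_one⟩, 1, 0, odd_one, rfl, le_rfl⟩

/-- Defects add, and the comparison with the earlier bound survives because $p+p'-1\le pp'$. -/
theorem HasDefect.mul {n m f g : ℕ} (h : HasDefect n f) (h' : HasDefect m g) :
    HasDefect (n * m) (f + g) := by
  obtain ⟨⟨M, hM, hs⟩, p, q, hp, hn, hf⟩ := h
  obtain ⟨⟨M', hM', hs'⟩, p', q', hp', hm, hg⟩ := h'
  refine ⟨⟨_, ?_, hs.mul hs'⟩, p * p', q + q', hp.mul hp', ?_, ?_⟩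
  · obtain ⟨a, rfl⟩ : ∃ a, n = a + 1 := ⟨n - 1, by omega⟩
    obtain ⟨b, rfl⟩ : ∃ b, m = b + 1 := ⟨m - 1, by omega⟩
    have : 2 * ((a + 1) * (b + 1)) = 2 * a * b + 2 * a + 2 * b + 2 := by ring
    simp only [Nat.add_sub_cancel]
    omega
  · rw [hn, hm, pow_add]
    ring
  · obtain ⟨a, rfl⟩ : ∃ a, p = a + 1 := ⟨p - 1, by have := hp.pos; omega⟩
    obtain ⟨b, rfl⟩ : ∃ b, p' = b + 1 := ⟨p' - 1, by have := hp'.pos; omega⟩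
    have : (a + 1) * (b + 1) = a * b + a + b + 1 := by ring
    have := Nat.zero_le (a * b)
    omega

theorem HasDefect.pow {n f : ℕ} (h : HasDefect n f) (a : ℕ) : HasDefect (n ^ a) (a * f) := by
  induction a with
  | zero => simpa using hasDefect_one
  | succ a ih =>
    rw [pow_succ, Nat.succ_mul]
    exact ih.mul h

theorem hasDefect_odd {n : ℕ} (hn : Odd n) (h : n ≠ 1) : HasDefect n ((n + 1) / 2) := by
  have hn' := hn
  obtain ⟨a, rfl⟩ := hn
  exact ⟨⟨3 * a - 1, by omega, hasShift_odd (by omega)⟩, _, 0, hn', by simp, by omega⟩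

/-- The contribution of the prime with index `i`. -/
noncomputable def primeDefect (i : ℕ) : ℕ :=
  if i = 0 then 1 else if i = 4 then 4 else (Nat.nth Nat.Prime i + 1) / 2

theorem odd_nth_prime {i : ℕ} (hi : i ≠ 0) : Odd (Nat.nth Nat.Prime i) := by
  refine (Nat.prime_nth_prime i).odd_of_ne_two fun h => hi ?_
  rw [← Nat.nth_prime_zero_eq_two] at h
  exact Nat.nth_injective Nat.infinite_setOfPred_prime h

theorem hasDefect_prime (i : ℕ) : HasDefect (Nat.nth Nat.Prime i) (primeDefect i) := by
  unfold primeDefect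
  split_ifs with h0 h4
  · rw [h0, Nat.nth_prime_zero_eq_two]
    exact ⟨⟨1, rfl, hasShift_two⟩, 1, 1, odd_one, rfl, le_rfl⟩
  · rw [h4, Nat.nth_prime_four_eq_eleven]
    exact ⟨⟨16, rfl, hasShift_eleven⟩, 11, 0, by decide, rfl, by norm_num⟩
  · exact hasDefect_odd (odd_nth_prime h0) (Nat.prime_nth_prime i).ne_one

theorem hasDefect_prod (α : ℕ →₀ ℕ) (s : Finset ℕ) :
    HasDefect (∏ i ∈ s, Nat.nth Nat.Prime i ^ α i) (∑ i ∈ s, α i * primeDefect i) := by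
  induction s using Finset.cons_induction with
  | empty => exact hasDefect_one
  | cons i s hi ih =>
    rw [Finset.prod_cons, Finset.sum_cons]
    exact ((hasDefect_prime i).pow (α i)).mul ih

/-- For $3,5,7$ the coefficients $2,3,4$ are already $(p+1)/2$; only $2$ and $11$ are exceptional.
-/
theorem A_eq (α : ℕ →₀ ℕ) : A α = ((∑ i ∈ α.support, α i * primeDefect i : ℕ) : ℚ) := by
  have hsmall : (∑ i ∈ α.support with ¬ 5 ≤ i, ((α i * primeDefect i : ℕ) : ℚ)) =
      ∑ i ∈ Finset.range 5, ((α i * primeDefect i : ℕ) : ℚ) := by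
    apply Finset.sum_subset
    · intro i hi
      simp only [Finset.mem_filter, Finset.mem_range] at hi ⊢
      omega
    · intro i hi hi'
      simp only [Finset.mem_filter, Finset.mem_range, Finsupp.mem_support_iff] at hi hi'
      have : α i = 0 := by
        by_contra h
        exact hi' ⟨h, by omega⟩
      simp [this]
  have hlarge : (∑ i ∈ α.support with 5 ≤ i, ((α i * primeDefect i : ℕ) : ℚ)) =
      1 / 2 * ∑ i ∈ α.support with 5 ≤ i, (α i : ℚ) * ((Nat.nth Nat.Prime i : ℚ) + 1) := by
    rw [Finset.mul_sum]
    refine Finset.sum_congr rfl fun i hi => ?_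
    have hi5 := (Finset.mem_filter.1 hi).2
    obtain ⟨b, hb⟩ := odd_nth_prime (i := i) (by omega)
    rw [primeDefect, if_neg (by omega), if_neg (by omega), hb,
      show (2 * b + 1 + 1) / 2 = b + 1 by omega]
    push_cast
    ring
  rw [Nat.cast_sum, ← Finset.sum_filter_add_sum_filter_not _ (fun i => 5 ≤ i), hsmall, hlarge, A]
  simp only [Finset.sum_range_succ, Finset.sum_range_zero, primeDefect, Nat.nth_prime_one_eq_three,
    Nat.nth_prime_two_eq_five, Nat.nth_prime_three_eq_seven]
  norm_num
  ring

theorem two_pow_mul_odd_unique {p q p' q' : ℕ} (hp : Odd p) (hp' : Odd p')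
    (h : p * 2 ^ q = p' * 2 ^ q') : p = p' ∧ q = q' := by
  wlog hle : q ≤ q' generalizing p q p' q'
  · obtain ⟨h1, h2⟩ := this hp' hp h.symm (by omega)
    exact ⟨h1.symm, h2.symm⟩
  obtain ⟨d, rfl⟩ := Nat.exists_eq_add_of_le hle
  have h1 : p = p' * 2 ^ d := by
    apply Nat.eq_of_mul_eq_mul_right (pow_pos two_pos q)
    rw [h, pow_add]
    ring
  rcases d with _ | d
  · exact ⟨by simpa using h1, rfl⟩
  · rw [h1, pow_succ, ← mul_assoc] at hp
    exact absurd hp (Nat.not_odd_iff_even.2 (even_two.mul_left _))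

end IntervalColoring

theorem mainTheorem8 (n k : ℕ) (hk : 1 ≤ k) (α : ℕ →₀ ℕ)
    (hn : n = α.prod fun i a => Nat.nth Nat.Prime i ^ a) :
    -- the Hamming graph is interval colorable, and the lower bound holds
    IntervalColoring.IntervalColorable (IntervalColoring.hammingGraph (2 * n) k) ∧
    IntervalColoring.lowerBound n k α ≤
      (IntervalColoring.W (IntervalColoring.hammingGraph (2 * n) k) : ℚ) ∧
    -- the bound is at least the earlier bound `(4n - 2 - p - q)k`, and larger for `k ≥ 2`
    ∀ p q : ℕ, Odd p → n = p * 2 ^ q →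
      (4 * n - 2 - p - q : ℚ) * k ≤ IntervalColoring.lowerBound n k α ∧
      (2 ≤ k → (4 * n - 2 - p - q : ℚ) * k < IntervalColoring.lowerBound n k α) := by
  have hdef := IntervalColoring.hasDefect_prod α α.support
  have hA := IntervalColoring.A_eq α
  rw [← Finsupp.prod, ← hn] at hdef
  generalize (∑ i ∈ α.support, α i * IntervalColoring.primeDefect i : ℕ) = f at hdef hA
  obtain ⟨⟨M, hM, hs⟩, p₀, q₀, hp₀, hn₀, hf⟩ := hdef
  obtain ⟨t, s, c, hc, ht⟩ := hs.exists_hammingGraph k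
  have hn1 : 1 ≤ n := by omega
  have hmem : t ∈ IntervalColoring.colorCounts (IntervalColoring.hammingGraph (2 * n) k) := by
    apply hc.mem_colorCounts
    obtain ⟨u, hu⟩ := hc.top
    have : 0 < k * (2 * n - 1) := Nat.mul_pos hk (by omega)
    omega
  have hMq : (M : ℚ) + f + 2 = 2 * n := by exact_mod_cast hM
  have hkq : (1 : ℚ) ≤ k := by exact_mod_cast hk
  have hnq : (1 : ℚ) ≤ n := by exact_mod_cast hn1
  have hbound : IntervalColoring.lowerBound n k α = t := by
    rw [IntervalColoring.lowerBound, ht, hA, show (M : ℚ) = 2 * n - f - 2 by linarith]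
    ring
  refine ⟨⟨t, hmem⟩, ?_, ?_⟩
  · rw [hbound]
    exact_mod_cast (IntervalColoring.isGreatest_W _ ⟨t, hmem⟩).2 hmem
  · intro p q hp hpq
    obtain ⟨rfl, rfl⟩ := IntervalColoring.two_pow_mul_odd_unique hp hp₀ (hpq.symm.trans hn₀)
    have hfq : (f : ℚ) + 1 ≤ p + q := by exact_mod_cast hf
    -- The linear term alone beats the earlier bound, as $f\le p+q-1$; strictness for $k\ge2$ comes
    -- from the quadratic term.
    have h1 : (4 * n - 2 - p - q : ℚ) * k ≤ (4 * n - 3 - f) * k :=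
      mul_le_mul_of_nonneg_right (by linarith) (by linarith)
    rw [IntervalColoring.lowerBound, hA]
    constructor
    · have : (0 : ℚ) ≤ 1 / 2 * k * (k - 1) * (2 * n - 1) :=
        mul_nonneg (mul_nonneg (by linarith) (by linarith)) (by linarith)
      linarith
    · intro hk2
      have hk2q : (2 : ℚ) ≤ k := by exact_mod_cast hk2
      have : (0 : ℚ) < 1 / 2 * k * (k - 1) * (2 * n - 1) :=
        mul_pos (mul_pos (by linarith) (by linarith)) (by linarith)
      linarith
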